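/- All C*-algebras are unital, all $*$-homomorphisms (morphisms) preserve units, and $\otimes$ is the spatial tensor product. For C*-algebras $B, A$ a \emph{noncommutative Feller--Markov operator} (NFMO) from $B$ to $A$ is a unit preserving completely positive linear map $\mathcal F:B\to A$. A \emph{random quantum map} (RQM) from $B$ to $A$ is a triple $(C,\phi,\nu)$ consisting of a C*-algebra $C$, a morphism $\phi:B\to A\otimes C$ and a state $\nu$ of $C$. It \emph{implements} the NFMO $\mathcal F$ if $\mathcal F(b)=(\mathrm{id}_A\otimes\nu)\phi(b)$ for all $b\in B$, where $\mathrm{id}_A\otimes\nu:A\otimes C\to A$ is the slice map $a\otimes c\mapsto\nu(c)a$; an NFMO is \emph{implemented} if some RQM implements it. \textbf{Theorem.} Let $\{\mathcal F_i\}_{i=1}^n$ be a finite family of implemented NFMOs from $B$ to $A$, and let $t_1,\dots,t_n\ge 0$ be real numbers with $\sum_{i=1}^n t_i=1$. Then the convex sum $\sum_{i=1}^n t_i\mathcal F_i$ is an implemented NFMO. More precisely: (a) The direct sum $\oplus_{i=1}^n\mathcal F_i:B^n\to A^n$, $(b_i)_i\mapsto(\mathcal F_i(b_i))_i$, is an implemented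 NFMO. (b) Let $(C,\phi,\nu)$ be any RQM from $B^n$ to $A^n$ which implements $\oplus_{i=1}^n\mathcal F_i$. There is a morphism $\Theta:A^n\otimes C\to A\otimes(\mathbb C^n\otimes C)$ such that $$\Theta\big((a_1,\dots,a_n)\otimes c\big)=\sum_{i=1}^n a_i\otimes(e_i\otimes c),$$ where $e_1,\dots,e_n$ is the standard basis of $\mathbb C^n$. Let $\psi:B\to A\otimes(\mathbb C^n\otimes C)$ be the composition of the diagonal morphism $b\mapsto(b,\dots,b)$ of $B$ into $B^n$, of $\phi$ and of $\Theta$, and let $\sigma$ be the state of $\mathbb C^n$ with $\sigma(e_i)=t_i$. Then $\sum_{i=1}^n t_i\mathcal F_i$ is implemented by the RQM $(\mathbb C^n\otimes C,\psi,\sigma\otimes\nu)$. -/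

import Mathlib

open scoped TensorProduct ComplexOrder InnerProductSpace

universe u v w

/-! ### The Hilbert space tensor product -/

/-- The algebraic tensor product of two Hilbert spaces with the inner product
`⟪h ⊗ k, h' ⊗ k'⟫ = ⟪h, h'⟫ ⟪k, k'⟫`. -/
def PreHilbertTensor (H : Type u) (K : Type w) [NormedAddCommGroup H] [InnerProductSpace ℂ H]
    [NormedAddCommGroup K] [InnerProductSpace ℂ K] : Type (max u w) :=
  H ⊗[ℂ] K

namespace PreHilbertTensor

variable {H : Type u} {K : Type w} [NormedAddCommGroup H] [InnerProductSpace ℂ H]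
  [NormedAddCommGroup K] [InnerProductSpace ℂ K]

noncomputable instance instNormedAddCommGroup : NormedAddCommGroup (PreHilbertTensor H K) :=
  inferInstanceAs (NormedAddCommGroup (H ⊗[ℂ] K))

noncomputable instance instInnerProductSpace : InnerProductSpace ℂ (PreHilbertTensor H K) :=
  inferInstanceAs (InnerProductSpace ℂ (H ⊗[ℂ] K))

end PreHilbertTensor

/-- The tensor product of two Hilbert spaces: the completion of the algebraic tensor product. -/
def HilbertTensor (H : Type u) (K : Type w) [NormedAddCommGroup H] [InnerProductSpace ℂ H]
    [NormedAddCommGroup K] [InnerProductSpace ℂ K] : Type (max u w) :=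
  UniformSpace.Completion (PreHilbertTensor H K)

namespace HilbertTensor

variable {H : Type u} {K : Type w} [NormedAddCommGroup H] [InnerProductSpace ℂ H]
  [NormedAddCommGroup K] [InnerProductSpace ℂ K]

noncomputable instance instNormedAddCommGroup : NormedAddCommGroup (HilbertTensor H K) :=
  inferInstanceAs (NormedAddCommGroup (UniformSpace.Completion (PreHilbertTensor H K)))

noncomputable instance instInnerProductSpace : InnerProductSpace ℂ (HilbertTensor H K) :=
  inferInstanceAs (InnerProductSpace ℂ (UniformSpace.Completion (PreHilbertTensor H K)))

instance instCompleteSpace : CompleteSpace (HilbertTensor H K) :=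
  inferInstanceAs (CompleteSpace (UniformSpace.Completion (PreHilbertTensor H K)))

/-- The inclusion of the algebraic tensor product. -/
noncomputable def ofPre : PreHilbertTensor H K →ₗᵢ[ℂ] HilbertTensor H K :=
  UniformSpace.Completion.toComplₗᵢ

/-- The elementary tensor `h ⊗ k`. -/
noncomputable def tmul (h : H) (k : K) : HilbertTensor H K :=
  ofPre (show PreHilbertTensor H K from h ⊗ₜ[ℂ] k)

theorem induction {p : HilbertTensor H K → Prop} (x : HilbertTensor H K) (hp : IsClosed {x | p x})
    (h : ∀ x, p (ofPre x)) : p x :=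
  UniformSpace.Completion.induction_on x hp h

theorem preInduction {p : PreHilbertTensor H K → Prop} (x : PreHilbertTensor H K) (h0 : p 0)
    (ht : ∀ (h : H) (k : K), p (show PreHilbertTensor H K from h ⊗ₜ[ℂ] k))
    (ha : ∀ x y, p x → p y → p (x + y)) : p x :=
  TensorProduct.induction_on x h0 ht ha

theorem inner_tmul (h h' : H) (k k' : K) :
    ⟪tmul h k, tmul h' k'⟫_ℂ = ⟪h, h'⟫_ℂ * ⟪k, k'⟫_ℂ :=
  UniformSpace.Completion.inner_coe _ _

theorem norm_tmul (h : H) (k : K) : ‖tmul h k‖ = ‖h‖ * ‖k‖ :=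
  (ofPre.norm_map _).trans (TensorProduct.norm_tmul h k)

/-- Continuous linear maps on `H ⊗ K` that agree on elementary tensors are equal. -/
theorem clm_ext {E : Type*} [NormedAddCommGroup E] [NormedSpace ℂ E]
    {S T : HilbertTensor H K →L[ℂ] E} (hST : ∀ h k, S (tmul h k) = T (tmul h k)) : S = T := by
  ext x
  induction x using induction with
  | hp => exact isClosed_eq S.continuous T.continuous
  | h x =>
    induction x using preInduction with
    | h0 => simp
    | ht h k => exact hST h k
    | ha x y hx hy => simp [hx, hy]

/-- The operator `S ⊗ T` on the algebraic tensor product. -/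
noncomputable def preMap (S : H →L[ℂ] H) (T : K →L[ℂ] K) :
    PreHilbertTensor H K →L[ℂ] PreHilbertTensor H K :=
  TensorProduct.mapL S T

theorem norm_preMap_le (S : H →L[ℂ] H) (T : K →L[ℂ] K) : ‖preMap S T‖ ≤ ‖S‖ * ‖T‖ :=
  TensorProduct.norm_mapL_le S T

/-- The bounded operator `S ⊗ T` on `H ⊗ K`, with `(S ⊗ T)(h ⊗ k) = S h ⊗ T k`. -/
noncomputable def map (S : H →L[ℂ] H) (T : K →L[ℂ] K) : HilbertTensor H K →L[ℂ] HilbertTensor H K :=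
  (preMap S T).completion

theorem map_ofPre (S : H →L[ℂ] H) (T : K →L[ℂ] K) (x : PreHilbertTensor H K) :
    map S T (ofPre x) = ofPre (preMap S T x) :=
  (preMap S T).completion_apply_coe x

theorem map_tmul (S : H →L[ℂ] H) (T : K →L[ℂ] K) (h : H) (k : K) :
    map S T (tmul h k) = tmul (S h) (T k) :=
  map_ofPre _ _ _

theorem norm_map_le (S : H →L[ℂ] H) (T : K →L[ℂ] K) : ‖map S T‖ ≤ ‖S‖ * ‖T‖ := by
  refine ContinuousLinearMap.opNorm_le_bound _
    (mul_nonneg (norm_nonneg S) (norm_nonneg T)) fun x => ?_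
  induction x using induction with
  | hp => exact isClosed_le (by fun_prop) (by fun_prop)
  | h x =>
    rw [map_ofPre, ofPre.norm_map, ofPre.norm_map]
    exact ContinuousLinearMap.le_of_opNorm_le _ (norm_preMap_le S T) x

theorem add_tmul (h h' : H) (k : K) : tmul (h + h') k = tmul h k + tmul h' k :=
  (congrArg ofPre (TensorProduct.add_tmul h h' k)).trans (ofPre.map_add _ _)

theorem tmul_add (h : H) (k k' : K) : tmul h (k + k') = tmul h k + tmul h k' :=
  (congrArg ofPre (TensorProduct.tmul_add h k k')).trans (ofPre.map_add _ _)

theorem smul_tmul (r : ℂ) (h : H) (k : K) : tmul (r • h) k = r • tmul h k :=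
  (congrArg ofPre (TensorProduct.smul_tmul' r h k).symm).trans (ofPre.map_smul _ _)

theorem tmul_smul (r : ℂ) (h : H) (k : K) : tmul h (r • k) = r • tmul h k :=
  (congrArg ofPre (TensorProduct.tmul_smul r h k)).trans (ofPre.map_smul _ _)

theorem map_mul (S S' : H →L[ℂ] H) (T T' : K →L[ℂ] K) :
    map (S * S') (T * T') = map S T * map S' T' :=
  clm_ext fun h k => by simp [map_tmul]

theorem map_star [CompleteSpace H] [CompleteSpace K] (S : H →L[ℂ] H) (T : K →L[ℂ] K) :
    map (star S) (star T) = star (map S T) := by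
  refine clm_ext fun h k => ext_inner_right ℂ fun x => ?_
  rw [ContinuousLinearMap.star_eq_adjoint (map S T), ContinuousLinearMap.adjoint_inner_left,
    map_tmul]
  have key : (innerSL ℂ (tmul ((star S) h) ((star T) k))) =
      (innerSL ℂ (tmul h k)).comp (map S T) := by
    refine clm_ext fun h' k' => ?_
    simp [map_tmul, inner_tmul, ContinuousLinearMap.star_eq_adjoint,
      ContinuousLinearMap.adjoint_inner_left]
  simpa using congrArg (fun f => f x) key

end HilbertTensor

/-! ### The spatial tensor product of C*-algebras -/

/-- The algebraic tensor product `A ⊙ C` of two C*-algebras (a type synonym, so that it can carry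
the spatial seminorm). -/
def AlgTensor (A : Type u) (C : Type w) [CStarAlgebra A] [CStarAlgebra C] : Type (max u w) :=
  A ⊗[ℂ] C

namespace AlgTensor

variable {A : Type u} {C : Type w} [CStarAlgebra A] [CStarAlgebra C]

noncomputable instance instRing : Ring (AlgTensor A C) := inferInstanceAs (Ring (A ⊗[ℂ] C))

noncomputable instance instAlgebra : Algebra ℂ (AlgTensor A C) :=
  inferInstanceAs (Algebra ℂ (A ⊗[ℂ] C))

noncomputable instance instStarAddMonoid : StarAddMonoid (AlgTensor A C) :=
  inferInstanceAs (StarAddMonoid (A ⊗[ℂ] C))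

instance instStarModule : StarModule ℂ (AlgTensor A C) :=
  inferInstanceAs (StarModule ℂ (A ⊗[ℂ] C))

/-- The elementary tensor `a ⊗ c`. -/
noncomputable def tmul (a : A) (c : C) : AlgTensor A C := a ⊗ₜ[ℂ] c

theorem induction {p : AlgTensor A C → Prop} (x : AlgTensor A C) (h0 : p 0)
    (ht : ∀ a c, p (tmul a c)) (ha : ∀ x y, p x → p y → p (x + y)) : p x :=
  TensorProduct.induction_on x h0 ht ha

theorem tmul_mul_tmul (a a' : A) (c c' : C) :
    tmul a c * tmul a' c' = tmul (a * a') (c * c') :=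
  Algebra.TensorProduct.tmul_mul_tmul a a' c c'

theorem star_tmul (a : A) (c : C) : star (tmul a c) = tmul (star a) (star c) := rfl

noncomputable instance instStarRing : StarRing (AlgTensor A C) where
  star_add := star_add
  star_mul x y := by
    induction x using induction with
    | h0 => simp
    | ha x x' hx hx' => simp [add_mul, mul_add, hx, hx']
    | ht a c =>
      induction y using induction with
      | h0 => simp
      | ha y y' hy hy' => simp [add_mul, mul_add, hy, hy']
      | ht a' c' => simp [tmul_mul_tmul, star_tmul]

section PairRep

variable {H : Type u} [NormedAddCommGroup H] [InnerProductSpace ℂ H] [CompleteSpace H]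
  {K : Type w} [NormedAddCommGroup K] [InnerProductSpace ℂ K] [CompleteSpace K]

/-- For representations `π` of `A` on `H` and `ρ` of `C` on `K`, the representation `π ⊗ ρ` of
`A ⊙ C` on the Hilbert space `H ⊗ K`, determined by `a ⊗ c ↦ π a ⊗ ρ c`. -/
noncomputable def pairRep (π : A →⋆ₐ[ℂ] (H →L[ℂ] H)) (ρ : C →⋆ₐ[ℂ] (K →L[ℂ] K)) :
    AlgTensor A C →ₗ[ℂ] (HilbertTensor H K →L[ℂ] HilbertTensor H K) :=
  TensorProduct.lift (LinearMap.mk₂ ℂ (fun (a : A) (c : C) => HilbertTensor.map (π a) (ρ c))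
    (fun a a' c => HilbertTensor.clm_ext fun h k => by
      simp [HilbertTensor.map_tmul, HilbertTensor.add_tmul])
    (fun r a c => HilbertTensor.clm_ext fun h k => by
      simp [HilbertTensor.map_tmul, HilbertTensor.smul_tmul])
    (fun a c c' => HilbertTensor.clm_ext fun h k => by
      simp [HilbertTensor.map_tmul, HilbertTensor.tmul_add])
    (fun r a c => HilbertTensor.clm_ext fun h k => by
      simp [HilbertTensor.map_tmul, HilbertTensor.tmul_smul]))

theorem pairRep_tmul (π : A →⋆ₐ[ℂ] (H →L[ℂ] H)) (ρ : C →⋆ₐ[ℂ] (K →L[ℂ] K)) (a : A) (c : C) :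
    pairRep π ρ (tmul a c) = HilbertTensor.map (π a) (ρ c) := rfl

theorem pairRep_mul (π : A →⋆ₐ[ℂ] (H →L[ℂ] H)) (ρ : C →⋆ₐ[ℂ] (K →L[ℂ] K))
    (x y : AlgTensor A C) : pairRep π ρ (x * y) = pairRep π ρ x * pairRep π ρ y := by
  induction x using induction with
  | h0 => simp
  | ha x x' hx hx' => simp [add_mul, hx, hx']
  | ht a c =>
    induction y using induction with
    | h0 => simp
    | ha y y' hy hy' => simp [mul_add, hy, hy']
    | ht a' c' => simp [tmul_mul_tmul, pairRep_tmul, HilbertTensor.map_mul]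

theorem pairRep_star (π : A →⋆ₐ[ℂ] (H →L[ℂ] H)) (ρ : C →⋆ₐ[ℂ] (K →L[ℂ] K))
    (x : AlgTensor A C) : pairRep π ρ (star x) = star (pairRep π ρ x) := by
  induction x using induction with
  | h0 => simp
  | ha x x' hx hx' => simp [hx, hx']
  | ht a c => simp [star_tmul, pairRep_tmul, map_star, HilbertTensor.map_star]

theorem norm_pairRep_sq (π : A →⋆ₐ[ℂ] (H →L[ℂ] H)) (ρ : C →⋆ₐ[ℂ] (K →L[ℂ] K))
    (x : AlgTensor A C) : ‖pairRep π ρ (star x * x)‖ = ‖pairRep π ρ x‖ ^ 2 := by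
  rw [pairRep_mul, pairRep_star, CStarRing.norm_star_mul_self, sq]

end PairRep

/-- The norms `‖(π ⊗ ρ)(x)‖`, for all representations `π` of `A` and `ρ` of `C` on Hilbert
spaces. -/
def repNorms (x : AlgTensor A C) : Set ℝ :=
  {r | ∃ (H : Type u) (_ : NormedAddCommGroup H) (_ : InnerProductSpace ℂ H) (_ : CompleteSpace H)
    (K : Type w) (_ : NormedAddCommGroup K) (_ : InnerProductSpace ℂ K) (_ : CompleteSpace K)
    (π : A →⋆ₐ[ℂ] (H →L[ℂ] H)) (ρ : C →⋆ₐ[ℂ] (K →L[ℂ] K)), r = ‖pairRep π ρ x‖}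

/-- The spatial (minimal) C*-norm on `A ⊙ C`: the supremum of `‖(π ⊗ ρ)(x)‖` over all
representations `π` of `A` and `ρ` of `C`. -/
noncomputable def spatialNorm (x : AlgTensor A C) : ℝ := sSup (repNorms x)

theorem bddAbove_repNorms (x : AlgTensor A C) : BddAbove (repNorms x) := by
  induction x using induction with
  | h0 =>
    refine ⟨0, ?_⟩
    rintro r ⟨H, _, _, _, K, _, _, _, π, ρ, rfl⟩
    simp
  | ht a c =>
    refine ⟨‖a‖ * ‖c‖, ?_⟩
    rintro r ⟨H, _, _, _, K, _, _, _, π, ρ, rfl⟩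
    rw [pairRep_tmul]
    refine (HilbertTensor.norm_map_le _ _).trans ?_
    gcongr
    · exact NonUnitalStarAlgHom.norm_apply_le π a
    · exact NonUnitalStarAlgHom.norm_apply_le ρ c
  | ha x y hx hy =>
    obtain ⟨M, hM⟩ := hx
    obtain ⟨N, hN⟩ := hy
    refine ⟨M + N, ?_⟩
    rintro r ⟨H, i1, i2, i3, K, i4, i5, i6, π, ρ, rfl⟩
    rw [map_add]
    exact (norm_add_le _ _).trans (add_le_add
      (hM ⟨H, i1, i2, i3, K, i4, i5, i6, π, ρ, rfl⟩) (hN ⟨H, i1, i2, i3, K, i4, i5, i6, π, ρ, rfl⟩))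

theorem norm_pairRep_le {H : Type u} [NormedAddCommGroup H] [InnerProductSpace ℂ H]
    [CompleteSpace H] {K : Type w} [NormedAddCommGroup K] [InnerProductSpace ℂ K] [CompleteSpace K]
    (π : A →⋆ₐ[ℂ] (H →L[ℂ] H)) (ρ : C →⋆ₐ[ℂ] (K →L[ℂ] K)) (x : AlgTensor A C) :
    ‖pairRep π ρ x‖ ≤ spatialNorm x :=
  le_csSup (bddAbove_repNorms x) ⟨H, _, _, inferInstance, K, _, _, inferInstance, π, ρ, rfl⟩

theorem spatialNorm_le {x : AlgTensor A C} {M : ℝ} (hM : 0 ≤ M)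
    (h : ∀ (H : Type u) [NormedAddCommGroup H] [InnerProductSpace ℂ H] [CompleteSpace H]
      (K : Type w) [NormedAddCommGroup K] [InnerProductSpace ℂ K] [CompleteSpace K]
      (π : A →⋆ₐ[ℂ] (H →L[ℂ] H)) (ρ : C →⋆ₐ[ℂ] (K →L[ℂ] K)), ‖pairRep π ρ x‖ ≤ M) :
    spatialNorm x ≤ M := by
  refine Real.sSup_le ?_ hM
  rintro r ⟨H, _, _, _, K, _, _, _, π, ρ, rfl⟩
  exact h H K π ρ

theorem spatialNorm_nonneg (x : AlgTensor A C) : 0 ≤ spatialNorm x := by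
  refine Real.sSup_nonneg ?_
  rintro r ⟨H, _, _, _, K, _, _, _, π, ρ, rfl⟩
  exact norm_nonneg _

theorem spatialNorm_mul_le (x y : AlgTensor A C) :
    spatialNorm (x * y) ≤ spatialNorm x * spatialNorm y := by
  refine spatialNorm_le (mul_nonneg (spatialNorm_nonneg _) (spatialNorm_nonneg _)) ?_
  intro H _ _ _ K _ _ _ π ρ
  rw [pairRep_mul]
  exact (norm_mul_le _ _).trans (mul_le_mul (norm_pairRep_le _ _ _) (norm_pairRep_le _ _ _)
    (norm_nonneg _) (spatialNorm_nonneg _))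

theorem spatialNorm_smul_le (r : ℂ) (x : AlgTensor A C) :
    spatialNorm (r • x) ≤ ‖r‖ * spatialNorm x := by
  refine spatialNorm_le (mul_nonneg (norm_nonneg _) (spatialNorm_nonneg _)) ?_
  intro H _ _ _ K _ _ _ π ρ
  rw [map_smul, norm_smul]
  gcongr
  exact norm_pairRep_le _ _ _

theorem spatialNorm_sq_le (x : AlgTensor A C) :
    spatialNorm x * spatialNorm x ≤ spatialNorm (star x * x) := by
  have h : spatialNorm x ≤ Real.sqrt (spatialNorm (star x * x)) := by
    refine spatialNorm_le (Real.sqrt_nonneg _) ?_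
    intro H _ _ _ K _ _ _ π ρ
    exact Real.le_sqrt_of_sq_le ((norm_pairRep_sq π ρ x).symm.le.trans (norm_pairRep_le _ _ _))
  calc _ ≤ Real.sqrt (spatialNorm (star x * x)) * Real.sqrt (spatialNorm (star x * x)) :=
        mul_self_le_mul_self (spatialNorm_nonneg _) h
    _ = _ := Real.mul_self_sqrt (spatialNorm_nonneg _)

/-- The spatial norm as a seminorm on the additive group `A ⊙ C`. -/
noncomputable def spatialSeminorm : AddGroupSeminorm (AlgTensor A C) where
  toFun := spatialNorm
  map_zero' := le_antisymm
    (spatialNorm_le le_rfl fun H _ _ _ K _ _ _ π ρ => by simp) (spatialNorm_nonneg _)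
  add_le' x y := by
    refine spatialNorm_le (add_nonneg (spatialNorm_nonneg _) (spatialNorm_nonneg _)) ?_
    intro H _ _ _ K _ _ _ π ρ
    rw [map_add]
    exact (norm_add_le _ _).trans (add_le_add (norm_pairRep_le _ _ _) (norm_pairRep_le _ _ _))
  neg' x := by
    have h : ∀ y : AlgTensor A C, repNorms (-y) = repNorms y := by
      intro y
      simp only [repNorms, map_neg, norm_neg]
    simp only [spatialNorm, h]

noncomputable instance instSeminormedRing : SeminormedRing (AlgTensor A C) where
  __ := instRing
  __ := (spatialSeminorm (A := A) (C := C)).toSeminormedAddCommGroup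
  norm_mul_le := spatialNorm_mul_le

theorem norm_def (x : AlgTensor A C) : ‖x‖ = spatialNorm x := rfl

noncomputable instance instNormedAlgebra : NormedAlgebra ℂ (AlgTensor A C) where
  __ := instAlgebra
  norm_smul_le := spatialNorm_smul_le

theorem norm_star_le (x : AlgTensor A C) : ‖star x‖ ≤ ‖x‖ := by
  have h1 : ‖star x‖ * ‖star x‖ ≤ ‖star (star x) * star x‖ := spatialNorm_sq_le (star x)
  have h2 : ‖star (star x) * star x‖ ≤ ‖x‖ * ‖star x‖ := by
    simpa using norm_mul_le x (star x)
  rcases (norm_nonneg (star x)).eq_or_lt with h | h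
  · rw [← h]; exact norm_nonneg x
  · exact le_of_mul_le_mul_right (h1.trans h2) h

instance instNormedStarGroup : NormedStarGroup (AlgTensor A C) where
  norm_star_le := norm_star_le

end AlgTensor

/-- The completion of a seminormed *-algebra whose seminorm is a C*-seminorm is a C*-algebra. -/
@[reducible]
noncomputable def cstarCompletion (R : Type u) [SeminormedRing R] [NormedAlgebra ℂ R] [StarRing R]
    [StarModule ℂ R] [NormedStarGroup R] (hR : ∀ x : R, ‖x‖ * ‖x‖ ≤ ‖star x * x‖) :
    CStarAlgebra (UniformSpace.Completion R) :=
  have hc : Continuous (UniformSpace.Completion.map (star : R → R)) :=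
    UniformSpace.Completion.continuous_map
  have hs : ∀ x : R, UniformSpace.Completion.map (star : R → R) (x : UniformSpace.Completion R) =
      ((star x : R) : UniformSpace.Completion R) :=
    UniformSpace.Completion.map_coe (starNormedAddGroupHom (E := R)).uniformContinuous
  { (inferInstance : NormedRing (UniformSpace.Completion R)),
    (inferInstance : Algebra ℂ (UniformSpace.Completion R)) with
    complete := (inferInstance : CompleteSpace (UniformSpace.Completion R)).complete
    norm_smul_le := fun r x => norm_smul_le r x
    star := UniformSpace.Completion.map (star : R → R)
    star_involutive := fun x => by
      induction x using UniformSpace.Completion.induction_on with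
      | hp => exact isClosed_eq (hc.comp hc) continuous_id
      | ih x => rw [hs, hs, star_star]
    star_mul := fun x y => by
      induction x, y using UniformSpace.Completion.induction_on₂ with
      | hp =>
        exact isClosed_eq (hc.comp continuous_mul)
          ((hc.comp continuous_snd).mul (hc.comp continuous_fst))
      | ih x y =>
        rw [← UniformSpace.Completion.coe_mul, hs, hs, hs, star_mul, UniformSpace.Completion.coe_mul]
    star_add := fun x y => by
      induction x, y using UniformSpace.Completion.induction_on₂ with
      | hp =>
        exact isClosed_eq (hc.comp continuous_add)
          ((hc.comp continuous_fst).add (hc.comp continuous_snd))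
      | ih x y =>
        rw [← UniformSpace.Completion.coe_add, hs, hs, hs, star_add, UniformSpace.Completion.coe_add]
    star_smul := fun r x => by
      induction x using UniformSpace.Completion.induction_on with
      | hp => exact isClosed_eq (hc.comp (continuous_const_smul r)) (hc.const_smul (star r))
      | ih x =>
        rw [← UniformSpace.Completion.coe_smul, hs]
        exact (congrArg _ (star_smul r x)).trans
          ((UniformSpace.Completion.coe_smul _ _).trans (congrArg _ (hs x).symm))
    norm_mul_self_le := fun x => by
      induction x using UniformSpace.Completion.induction_on with
      | hp => exact isClosed_le (by fun_prop) ((hc.mul continuous_id).norm)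
      | ih x =>
        calc _ = ‖x‖ * ‖x‖ := by rw [UniformSpace.Completion.norm_coe]
          _ ≤ ‖star x * x‖ := hR x
          _ = _ := by
            rw [← UniformSpace.Completion.norm_coe, UniformSpace.Completion.coe_mul, ← hs]
            rfl }

/-- The spatial tensor product `A ⊗ C` of two C*-algebras: the completion of `A ⊙ C` in the spatial
norm. -/
def SpatialTensor (A : Type u) (C : Type w) [CStarAlgebra A] [CStarAlgebra C] : Type (max u w) :=
  UniformSpace.Completion (AlgTensor A C)

namespace SpatialTensor

variable {A : Type u} {C : Type w} [CStarAlgebra A] [CStarAlgebra C]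

noncomputable instance instCStarAlgebra : CStarAlgebra (SpatialTensor A C) :=
  cstarCompletion (AlgTensor A C) AlgTensor.spatialNorm_sq_le

/-- The canonical *-homomorphism `A ⊙ C → A ⊗ C`. -/
noncomputable def of : AlgTensor A C →⋆ₐ[ℂ] SpatialTensor A C where
  toFun x := (x : UniformSpace.Completion (AlgTensor A C))
  map_one' := UniformSpace.Completion.coe_one (AlgTensor A C)
  map_mul' := UniformSpace.Completion.coe_mul
  map_zero' := UniformSpace.Completion.coe_zero
  map_add' := UniformSpace.Completion.coe_add
  commutes' _ := rfl
  map_star' x := (UniformSpace.Completion.map_coe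
    (starNormedAddGroupHom (E := AlgTensor A C)).uniformContinuous x).symm

theorem norm_of (x : AlgTensor A C) : ‖of x‖ = ‖x‖ := UniformSpace.Completion.norm_coe x

theorem denseRange_of : DenseRange (of : AlgTensor A C → SpatialTensor A C) :=
  UniformSpace.Completion.denseRange_coe

/-- The elementary tensor `a ⊗ c` in the spatial tensor product. -/
noncomputable def tmul (a : A) (c : C) : SpatialTensor A C := of (AlgTensor.tmul a c)

end SpatialTensor

/-! ### States and slice maps -/

/-- A state of a C*-algebra: a positive linear functional `ν` with `ν 1 = 1`. -/
structure CStarState (C : Type w) [CStarAlgebra C] extends C →ₗ[ℂ] ℂ where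
  nonneg' : ∀ c, 0 ≤ toFun (star c * c)
  map_one' : toFun 1 = 1

namespace CStarState

instance instFunLike {C : Type w} [CStarAlgebra C] : FunLike (CStarState C) C ℂ where
  coe ν := ν.toFun
  coe_injective ν ν' h := by
    obtain ⟨ν, _, _⟩ := ν
    obtain ⟨ν', _, _⟩ := ν'
    congr
    exact DFunLike.coe_injective h

variable {C : Type w} [CStarAlgebra C]

instance instLinearMapClass : LinearMapClass (CStarState C) ℂ C ℂ where
  map_add ν := ν.toLinearMap.map_add
  map_smulₛₗ ν := ν.toLinearMap.map_smul

theorem nonneg (ν : CStarState C) (c : C) : 0 ≤ ν (star c * c) := ν.nonneg' c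

theorem map_one (ν : CStarState C) : ν 1 = 1 := ν.map_one'

/-- A contractive functional `g` with `g 1 = 1` is a state. -/
theorem nonneg_of_contractive (g : StrongDual ℂ C) (hg : ‖g‖ ≤ 1) (h1 : g 1 = 1) (c : C) :
    0 ≤ g (star c * c) := by
  let _ := CStarAlgebra.spectralOrder C
  have _ := CStarAlgebra.spectralOrderedRing C
  have hle : ∀ x : C, ‖g x‖ ≤ ‖x‖ := fun x => by
    simpa using ContinuousLinearMap.le_of_opNorm_le g hg x
  have him : ∀ x : C, IsSelfAdjoint x → (g x).im = 0 := by
    intro x hx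
    have hbound : ∀ s : ℝ, ((g x).im + s) ^ 2 ≤ ‖x‖ ^ 2 + s ^ 2 := by
      intro s
      have h2 : ‖g (x + (Complex.I * s) • (1 : C))‖ ^ 2 ≤ ‖x‖ ^ 2 + s ^ 2 := by
        calc _ ≤ ‖x + (Complex.I * s) • (1 : C)‖ ^ 2 := by gcongr; exact hle _
          _ = ‖star (x + (Complex.I * s) • (1 : C)) * (x + (Complex.I * s) • (1 : C))‖ := by
            rw [CStarRing.norm_star_mul_self, sq]
          _ = ‖star x * x + ((s : ℂ) ^ 2) • (1 : C)‖ := by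
            congr 1
            rw [star_add, star_smul, star_one, hx.star_eq]
            simp only [add_mul, mul_add, smul_mul_assoc, mul_smul_comm, one_mul, mul_one]
            simp only [star_mul', Complex.star_def, Complex.conj_I, Complex.conj_ofReal]
            have : (-Complex.I * (s : ℂ)) * (Complex.I * s) = (s : ℂ) ^ 2 := by
              linear_combination (-(s : ℂ) ^ 2) * Complex.I_mul_I
            rw [smul_add, smul_smul, mul_comm (Complex.I * (s : ℂ)), this]
            module
          _ ≤ ‖star x * x‖ + ‖((s : ℂ) ^ 2) • (1 : C)‖ := norm_add_le _ _
          _ ≤ ‖x‖ ^ 2 + s ^ 2 := by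
            rw [CStarRing.norm_star_mul_self, norm_smul]
            have h3 : ‖(1 : C)‖ ≤ 1 := by
              nontriviality C
              exact CStarRing.norm_one.le
            have h4 : ‖(s : ℂ) ^ 2‖ = s ^ 2 := by simp
            rw [h4]
            nlinarith [sq_nonneg s]
      have h5 : ((g x).im + s) ^ 2 ≤ ‖g (x + (Complex.I * s) • (1 : C))‖ ^ 2 := by
        rw [_root_.map_add, _root_.map_smul, h1, ← Complex.normSq_eq_norm_sq, Complex.normSq_apply]
        simp
        nlinarith [sq_nonneg (g x).re]
      exact h5.trans h2
    by_contra hne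
    have := hbound (‖x‖ ^ 2 / (g x).im)
    have h6 : ((g x).im + ‖x‖ ^ 2 / (g x).im) ^ 2 =
        (g x).im ^ 2 + 2 * ‖x‖ ^ 2 + (‖x‖ ^ 2 / (g x).im) ^ 2 := by
      field_simp
      ring
    nlinarith [sq_nonneg ‖x‖, pow_pos (abs_pos.mpr hne) 2, sq_abs (g x).im]
  set p := star c * c with hp
  have hpsa : IsSelfAdjoint p := .star_mul_self c
  have hp0 : 0 ≤ p := star_mul_self_nonneg c
  have hle2 : ‖(‖p‖ : ℂ) • (1 : C) - p‖ ≤ ‖p‖ := by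
    have hq : 0 ≤ (‖p‖ : ℂ) • (1 : C) - p := by
      rw [Complex.coe_smul, sub_nonneg, ← Algebra.algebraMap_eq_smul_one]
      exact hpsa.le_algebraMap_norm_self
    rw [CStarAlgebra.norm_le_iff_le_algebraMap _ (norm_nonneg p) hq,
      Algebra.algebraMap_eq_smul_one, Complex.coe_smul]
    exact sub_le_self _ hp0
  have h7 : ‖(‖p‖ : ℂ) - g p‖ ≤ ‖p‖ := by
    have := (hle _).trans hle2
    rwa [map_sub, _root_.map_smul, h1, smul_eq_mul, mul_one] at this
  have h8 := (Complex.abs_re_le_norm _).trans h7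
  rw [Complex.sub_re, Complex.ofReal_re] at h8
  rw [Complex.nonneg_iff]
  exact ⟨by linarith [(abs_le.mp h8).2], (him p hpsa).symm⟩

/-- Norms in a C*-algebra are detected by states. -/
theorem exists_apply_star_mul_self {A : Type u} [CStarAlgebra A] [Nontrivial A] (a : A) :
    ∃ f : CStarState A, f (star a * a) = (‖a‖ : ℂ) ^ 2 := by
  let _ := CStarAlgebra.spectralOrder A
  have _ := CStarAlgebra.spectralOrderedRing A
  set b := star a * a with hb
  have hbsa : IsSelfAdjoint b := .star_mul_self a
  have hb0 : 0 ≤ b := star_mul_self_nonneg a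
  have hnb : ‖b‖ = ‖a‖ ^ 2 := by rw [hb, CStarRing.norm_star_mul_self, sq]
  have hone : 1 ≤ ‖1 + b‖ := by
    rw [← CStarRing.norm_one (E := A)]
    exact CStarAlgebra.norm_le_norm_of_nonneg_of_le zero_le_one (le_add_of_nonneg_right hb0)
  have hnorm : 1 + ‖b‖ ≤ ‖1 + b‖ := by
    have : ‖b‖ ≤ ‖1 + b‖ - 1 := by
      rw [CStarAlgebra.norm_le_iff_le_algebraMap _ (by linarith) hb0, map_sub, _root_.map_one,
        le_sub_iff_add_le, add_comm]
      exact ((IsSelfAdjoint.one A).add hbsa).le_algebraMap_norm_self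
    linarith
  obtain ⟨g, hg, hgx⟩ := exists_dual_vector'' ℂ (1 + b)
  have hle : ∀ x : A, ‖g x‖ ≤ ‖x‖ := fun x => by
    simpa using ContinuousLinearMap.le_of_opNorm_le g hg x
  have e1 : (g 1).re ≤ 1 := (Complex.re_le_norm _).trans ((hle 1).trans CStarRing.norm_one.le)
  have e2 : (g b).re ≤ ‖b‖ := (Complex.re_le_norm _).trans (hle b)
  have e3 : (g 1).re + (g b).re = ‖1 + b‖ := by
    rw [_root_.map_add] at hgx
    simpa using congrArg Complex.re hgx
  have key : ∀ (z : ℂ) (r : ℝ), z.re = r → ‖z‖ ≤ r → z = r := by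
    intro z r h1 h2
    have : z.im ^ 2 ≤ 0 := by
      have h3 := Complex.normSq_eq_norm_sq z
      rw [Complex.normSq_apply, h1] at h3
      nlinarith [norm_nonneg z]
    apply Complex.ext
    · simpa using h1
    · simpa using pow_eq_zero_iff (two_ne_zero) |>.mp (le_antisymm this (sq_nonneg _))
  have g1 : g 1 = 1 := by
    have := key (g 1) 1 (by linarith) ((hle 1).trans CStarRing.norm_one.le)
    simpa using this
  have gb : g b = ‖b‖ := key (g b) ‖b‖ (by linarith) (hle b)
  refine ⟨⟨g.toLinearMap, nonneg_of_contractive g hg g1, g1⟩, ?_⟩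
  change g b = _
  rw [gb, hnb]
  simp

/-- The cyclic representation of a state (Gelfand, Naimark, Segal). -/
theorem exists_cyclic (f : CStarState C) :
    ∃ (H : Type w) (_ : NormedAddCommGroup H) (_ : InnerProductSpace ℂ H) (_ : CompleteSpace H)
      (π : C →⋆ₐ[ℂ] (H →L[ℂ] H)) (ξ : H), ∀ c, ⟪ξ, π c ξ⟫_ℂ = f c := by
  let _ := CStarAlgebra.spectralOrder C
  have _ := CStarAlgebra.spectralOrderedRing C
  let F : C →ₚ[ℂ] ℂ := PositiveLinearMap.mk₀ f.toLinearMap fun x hx => by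
    obtain ⟨c, rfl⟩ := CStarAlgebra.nonneg_iff_eq_star_mul_self.mp hx
    exact f.nonneg c
  refine ⟨F.GNS, inferInstance, inferInstance, inferInstance, F.gnsStarAlgHom,
    ((F.toPreGNS 1 : F.PreGNS) : F.GNS), fun c => ?_⟩
  change ⟪((F.toPreGNS 1 : F.PreGNS) : F.GNS),
    F.gnsNonUnitalStarAlgHom c ((F.toPreGNS 1 : F.PreGNS) : F.GNS)⟫_ℂ = f c
  rw [PositiveLinearMap.gnsNonUnitalStarAlgHom_apply_coe,
    UniformSpace.Completion.inner_coe, PositiveLinearMap.preGNS_inner_def]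
  simp
  rfl

end CStarState

namespace AlgTensor

variable {A : Type u} {C : Type w} [CStarAlgebra A] [CStarAlgebra C]

/-- The slice map `id ⊗ ν : A ⊙ C → A`, with `a ⊗ c ↦ ν(c) a`. -/
noncomputable def slice (ν : CStarState C) : AlgTensor A C →ₗ[ℂ] A :=
  TensorProduct.lift (LinearMap.mk₂ ℂ (fun (a : A) (c : C) => ν.toLinearMap c • a)
    (fun a a' c => smul_add _ _ _) (fun r a c => smul_comm _ _ _)
    (fun a c c' => by rw [map_add, add_smul]) (fun r a c => by rw [map_smul, smul_assoc]))

theorem slice_tmul (ν : CStarState C) (a : A) (c : C) : slice ν (tmul a c) = ν c • a := rfl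

theorem norm_eq_one_of_inner_self {E : Type*} [NormedAddCommGroup E] [InnerProductSpace ℂ E]
    {e : E} (he : ⟪e, e⟫_ℂ = 1) : ‖e‖ = 1 := by
  rw [norm_eq_sqrt_re_inner (𝕜 := ℂ), he]
  simp

theorem norm_slice_le (ν : CStarState C) (x : AlgTensor A C) : ‖slice ν x‖ ≤ ‖x‖ := by
  set y := slice ν x with hy
  rcases eq_or_ne y 0 with h0 | h0
  · rw [h0, norm_zero]
    exact norm_nonneg x
  have : Nontrivial A := ⟨⟨y, 0, h0⟩⟩
  obtain ⟨f, hf⟩ := CStarState.exists_apply_star_mul_self y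
  obtain ⟨H, _, _, _, π, ξ, hξ⟩ := f.exists_cyclic
  obtain ⟨K, _, _, _, ρ, η, hη⟩ := ν.exists_cyclic
  have hξ1 : ‖ξ‖ = 1 := norm_eq_one_of_inner_self (by rw [← f.map_one, ← hξ, map_one, one_apply_eq_self])
  have hη1 : ‖η‖ = 1 := norm_eq_one_of_inner_self (by rw [← ν.map_one, ← hη, map_one, one_apply_eq_self])
  have hyξ : ⟪π y ξ, π y ξ⟫_ℂ = (‖y‖ : ℂ) ^ 2 := by
    rw [← hf, ← hξ, map_mul, map_star, ContinuousLinearMap.star_eq_adjoint,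
      mul_apply_eq_comp, ContinuousLinearMap.adjoint_inner_right]
  have hnyξ : ‖π y ξ‖ = ‖y‖ := by
    have h : ‖π y ξ‖ ^ 2 = ‖y‖ ^ 2 := by
      rw [← inner_self_eq_norm_sq (𝕜 := ℂ), hyξ, ← Complex.ofReal_pow]
      rfl
    exact (sq_eq_sq₀ (norm_nonneg _) (norm_nonneg _)).mp h
  have key : ∀ z : AlgTensor A C,
      ⟪HilbertTensor.tmul (π y ξ) η, pairRep π ρ z (HilbertTensor.tmul ξ η)⟫_ℂ =
        ⟪π y ξ, π (slice ν z) ξ⟫_ℂ := by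
    intro z
    induction z using induction with
    | h0 => simp
    | ha z z' hz hz' => simp [hz, hz']
    | ht a c =>
      rw [pairRep_tmul, HilbertTensor.map_tmul, HilbertTensor.inner_tmul, hη, slice_tmul,
        map_smul, smul_apply, inner_smul_right, mul_comm]
  have h1 : ‖y‖ ^ 2 ≤ ‖y‖ * ‖x‖ := by
    calc ‖y‖ ^ 2 = ‖⟪π y ξ, π y ξ⟫_ℂ‖ := by rw [hyξ]; simp
      _ = ‖⟪HilbertTensor.tmul (π y ξ) η, pairRep π ρ x (HilbertTensor.tmul ξ η)⟫_ℂ‖ := by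
        rw [key x]
      _ ≤ ‖HilbertTensor.tmul (π y ξ) η‖ * ‖pairRep π ρ x (HilbertTensor.tmul ξ η)‖ :=
        norm_inner_le_norm _ _
      _ ≤ ‖HilbertTensor.tmul (π y ξ) η‖ * (‖pairRep π ρ x‖ * ‖HilbertTensor.tmul ξ η‖) := by
        gcongr
        exact ContinuousLinearMap.le_opNorm _ _
      _ = ‖y‖ * ‖pairRep π ρ x‖ := by
        rw [HilbertTensor.norm_tmul, HilbertTensor.norm_tmul, hξ1, hη1, hnyξ]
        ring
      _ ≤ ‖y‖ * ‖x‖ := by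
        gcongr
        exact norm_pairRep_le π ρ x
  have hpos : 0 < ‖y‖ := norm_pos_iff.mpr h0
  rw [sq] at h1
  exact le_of_mul_le_mul_left h1 hpos

/-- The slice map as a continuous linear map. -/
noncomputable def sliceL (ν : CStarState C) : AlgTensor A C →L[ℂ] A :=
  (slice ν).mkContinuous 1 fun x => by rw [one_mul]; exact norm_slice_le ν x

end AlgTensor

/-- The slice map `id ⊗ ν : A ⊗ C → A` of a state `ν` of `C`: the continuous linear map with
`a ⊗ c ↦ ν(c) a`. -/
noncomputable def SpatialTensor.slice {A : Type u} {C : Type w} [CStarAlgebra A] [CStarAlgebra C]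
    (ν : CStarState C) : SpatialTensor A C →L[ℂ] A :=
  (AlgTensor.sliceL ν).fromCompletion

theorem SpatialTensor.slice_of {A : Type u} {C : Type w} [CStarAlgebra A] [CStarAlgebra C]
    (ν : CStarState C) (x : AlgTensor A C) :
    SpatialTensor.slice ν (SpatialTensor.of x) = AlgTensor.slice ν x :=
  (AlgTensor.sliceL ν).fromCompletion_apply_coe x

theorem SpatialTensor.slice_tmul {A : Type u} {C : Type w} [CStarAlgebra A] [CStarAlgebra C]
    (ν : CStarState C) (a : A) (c : C) :
    SpatialTensor.slice ν (SpatialTensor.tmul a c) = ν c • a :=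
  SpatialTensor.slice_of ν _

namespace CStarState

variable {A : Type u} {C : Type w} [CStarAlgebra A] [CStarAlgebra C]

theorem continuous_state (f : CStarState A) : Continuous f.toLinearMap := by
  let _ := CStarAlgebra.spectralOrder A
  have _ := CStarAlgebra.spectralOrderedRing A
  let F : A →ₚ[ℂ] ℂ := PositiveLinearMap.mk₀ f.toLinearMap fun x hx => by
    obtain ⟨c, rfl⟩ := CStarAlgebra.nonneg_iff_eq_star_mul_self.mp hx
    exact f.nonneg c
  exact map_continuous F

theorem prod_nonneg (f : CStarState A) (ν : CStarState C) (x : AlgTensor A C) :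
    0 ≤ f (AlgTensor.slice ν (star x * x)) := by
  obtain ⟨H, _, _, _, π, ξ, hξ⟩ := f.exists_cyclic
  obtain ⟨K, _, _, _, ρ, η, hη⟩ := ν.exists_cyclic
  have key : ∀ z : AlgTensor A C, f (AlgTensor.slice ν z) =
      ⟪HilbertTensor.tmul ξ η, AlgTensor.pairRep π ρ z (HilbertTensor.tmul ξ η)⟫_ℂ := by
    intro z
    induction z using AlgTensor.induction with
    | h0 =>
      rw [_root_.map_zero, _root_.map_zero, _root_.map_zero, zero_apply, inner_zero_right]
    | ha z z' hz hz' =>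
      rw [_root_.map_add, _root_.map_add, _root_.map_add, add_apply, inner_add_right, ← hz, ← hz']
    | ht a c =>
      rw [AlgTensor.pairRep_tmul, HilbertTensor.map_tmul, HilbertTensor.inner_tmul, hξ, hη,
        AlgTensor.slice_tmul, mul_comm, _root_.map_smul, smul_eq_mul]
  rw [key, AlgTensor.pairRep_mul, AlgTensor.pairRep_star, mul_apply_eq_comp,
    ContinuousLinearMap.star_eq_adjoint, ContinuousLinearMap.adjoint_inner_right]
  exact Complex.nonneg_iff.mpr
    ⟨inner_self_nonneg (𝕜 := ℂ), (inner_self_im (𝕜 := ℂ) _).symm⟩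

/-- The product state `f ⊗ ν` of `A ⊗ C`, with `(f ⊗ ν)(a ⊗ c) = f(a) ν(c)`. -/
noncomputable def prod (f : CStarState A) (ν : CStarState C) : CStarState (SpatialTensor A C) where
  toLinearMap := f.toLinearMap ∘ₗ (SpatialTensor.slice ν).toLinearMap
  nonneg' z := by
    change 0 ≤ f.toLinearMap (SpatialTensor.slice ν (star z * z))
    refine SpatialTensor.denseRange_of.induction_on
      (p := fun z => 0 ≤ f.toLinearMap (SpatialTensor.slice ν (star z * z))) z ?_ fun x => ?_
    · exact isClosed_le continuous_const (f.continuous_state.comp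
        ((SpatialTensor.slice ν).continuous.comp (by fun_prop)))
    · rw [← map_star, ← _root_.map_mul, SpatialTensor.slice_of]
      exact prod_nonneg f ν x
  map_one' := by
    change f.toLinearMap (SpatialTensor.slice ν 1) = 1
    rw [← _root_.map_one SpatialTensor.of, SpatialTensor.slice_of]
    change f.toLinearMap (AlgTensor.slice ν (AlgTensor.tmul 1 1)) = 1
    rw [AlgTensor.slice_tmul, ν.map_one, one_smul]
    exact f.map_one

theorem prod_tmul (f : CStarState A) (ν : CStarState C) (a : A) (c : C) :
    f.prod ν (SpatialTensor.tmul a c) = f a * ν c := by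
  change f.toLinearMap (SpatialTensor.slice ν (SpatialTensor.tmul a c)) = _
  rw [SpatialTensor.slice_tmul, _root_.map_smul, smul_eq_mul, mul_comm]
  rfl

/-- The state of `ℂⁿ` with `e i ↦ t i`, where `t i ≥ 0` and `∑ i, t i = 1`. -/
noncomputable def ofWeights {n : ℕ} (t : Fin n → ℝ) (ht : ∀ i, 0 ≤ t i) (hsum : ∑ i, t i = 1) :
    CStarState (Fin n → ℂ) where
  toLinearMap := ∑ i, (t i : ℂ) • LinearMap.proj i
  nonneg' z := by
    change 0 ≤ (∑ i, (t i : ℂ) • LinearMap.proj i : (Fin n → ℂ) →ₗ[ℂ] ℂ) (star z * z)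
    rw [LinearMap.sum_apply]
    exact Finset.sum_nonneg fun i _ =>
      mul_nonneg (Complex.zero_le_real.mpr (ht i)) (star_mul_self_nonneg (z i))
  map_one' := by
    change (∑ i, (t i : ℂ) • LinearMap.proj i : (Fin n → ℂ) →ₗ[ℂ] ℂ) 1 = 1
    rw [LinearMap.sum_apply]
    simp [← Complex.ofReal_sum, hsum]

end CStarState

/-! ### Noncommutative Feller-Markov operators and random quantum maps -/

/-- A noncommutative Feller-Markov operator from `B` to `A`: a completely positive linear map
`B → A` with `1 ↦ 1`. -/
structure NFMO (B : Type v) (A : Type u) [CStarAlgebra B] [PartialOrder B] [StarOrderedRing B]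
    [CStarAlgebra A] [PartialOrder A] [StarOrderedRing A] extends CompletelyPositiveMap B A where
  map_one' : toFun 1 = 1

/-- A random quantum map from `B` to `A`: a C*-algebra `C`, a unital *-homomorphism
`φ : B → A ⊗ C` and a state `ν` of `C`. -/
structure RQM (B : Type v) (A : Type u) [CStarAlgebra B] [CStarAlgebra A] where
  /-- the parameter algebra -/
  C : Type w
  [instC : CStarAlgebra C]
  /-- the quantum family of maps -/
  φ : B →⋆ₐ[ℂ] SpatialTensor A C
  /-- the state -/
  ν : CStarState C

attribute [instance] RQM.instC

/-- The operator `b ↦ (id ⊗ ν) (φ b)` of a random quantum map. -/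
noncomputable def RQM.operator {B : Type v} {A : Type u} [CStarAlgebra B] [CStarAlgebra A]
    (R : RQM.{u, v, w} B A) : B →ₗ[ℂ] A :=
  (SpatialTensor.slice R.ν).toLinearMap ∘ₗ R.φ.toAlgHom.toLinearMap

namespace NFMO

variable {A : Type u} {B : Type v} [CStarAlgebra A] [PartialOrder A] [StarOrderedRing A]
  [CStarAlgebra B] [PartialOrder B] [StarOrderedRing B]

/-- The operator `F` is implemented by the random quantum map `R`. -/
def ImplementedBy (F : NFMO B A) (R : RQM.{u, v, w} B A) : Prop :=
  F.toLinearMap = R.operator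

/-- The operator `F` is implemented by some random quantum map. -/
def Implemented (F : NFMO B A) : Prop :=
  ∃ R : RQM.{u, v, w} B A, F.ImplementedBy R

/-- The convex sum `∑ i, t i • F i`. -/
noncomputable def convexSum {n : ℕ} (F : Fin n → NFMO B A) (t : Fin n → ℝ) (ht : ∀ i, 0 ≤ t i)
    (hsum : ∑ i, t i = 1) : NFMO B A where
  toLinearMap := ∑ i, (t i : ℂ) • (F i).toLinearMap
  map_cstarMatrix_nonneg' k M hM := by
    have h : M.map (∑ i, (t i : ℂ) • (F i).toLinearMap : B →ₗ[ℂ] A) =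
        ∑ i, t i • M.map (F i).toLinearMap := by
      ext a b
      have h2 : ∀ s : Finset (Fin n), (∑ i ∈ s, t i • M.map (F i).toLinearMap) a b =
          ∑ i ∈ s, t i • (F i).toLinearMap (M a b) := by
        intro s
        induction s using Finset.cons_induction with
        | empty => rfl
        | cons i s hi ih =>
          rw [Finset.sum_cons, Finset.sum_cons, CStarMatrix.add_apply, ih]
          rfl
      rw [h2, CStarMatrix.map_apply, LinearMap.sum_apply]
      exact Finset.sum_congr rfl fun i _ => Complex.coe_smul _ _
    rw [h]
    exact Finset.sum_nonneg fun i _ => smul_nonneg (ht i) ((F i).map_cstarMatrix_nonneg' k M hM)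
  map_one' := by
    change (∑ i, (t i : ℂ) • (F i).toLinearMap : B →ₗ[ℂ] A) 1 = 1
    rw [LinearMap.sum_apply]
    calc _ = ∑ i, (t i : ℂ) • (1 : A) :=
          Finset.sum_congr rfl fun i _ => congrArg ((t i : ℂ) • ·) (F i).map_one'
      _ = 1 := by rw [← Finset.sum_smul, ← Complex.ofReal_sum, hsum, Complex.ofReal_one, one_smul]

theorem exists_eq_star_mul_self {R : Type*} [CStarAlgebra R] [PartialOrder R] [StarOrderedRing R]
    {x : R} (hx : 0 ≤ x) : ∃ y, x = star y * y :=
  CStarAlgebra.nonneg_iff_eq_star_mul_self.mp hx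

/-- The direct sum `⨁ i, F i : Bⁿ → Aⁿ`, with `(b i)ᵢ ↦ (F i (b i))ᵢ`. -/
noncomputable def directSum {n : ℕ} (F : Fin n → NFMO B A) : NFMO (Fin n → B) (Fin n → A) where
  toLinearMap := LinearMap.pi fun i => (F i).toLinearMap ∘ₗ LinearMap.proj i
  map_cstarMatrix_nonneg' k M hM := by
    have h : ∀ i, ∃ X : CStarMatrix (Fin k) (Fin k) A,
        M.map (fun b => (F i).toLinearMap (b i)) = star X * X := by
      intro i
      refine exists_eq_star_mul_self ?_
      have h1 : 0 ≤ M.map (Pi.evalStarAlgHom ℂ (fun _ : Fin n => B) i) :=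
        CompletelyPositiveMapClass.map_cstarMatrix_nonneg' _ k M hM
      exact (F i).map_cstarMatrix_nonneg' k _ h1
    choose X hX using h
    let Y : CStarMatrix (Fin k) (Fin k) (Fin n → A) := CStarMatrix.ofMatrix fun a b i => X i a b
    refine (star_mul_self_nonneg Y).trans_eq (Eq.symm ?_)
    ext a b i
    have h2 := CStarMatrix.ext_iff.mpr (hX i) a b
    rw [CStarMatrix.map_apply, CStarMatrix.mul_apply] at h2
    rw [CStarMatrix.mul_apply, Finset.sum_apply]
    exact h2
  map_one' := funext fun i => (F i).map_one'

end NFMO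

/-- The diagonal embedding `b ↦ (b, …, b)` of `B` into `Bⁿ`. -/
def diagonalHom (B : Type v) [CStarAlgebra B] (n : ℕ) : B →⋆ₐ[ℂ] (Fin n → B) where
  toFun b := fun _ => b
  map_one' := rfl
  map_mul' _ _ := rfl
  map_zero' := rfl
  map_add' _ _ := rfl
  commutes' _ := rfl
  map_star' _ := rfl

/-! A convex combination is an average over a random index, and the index can be recorded in the
parameter algebra. If all `F i` are implemented with one parameter algebra `C` and one state `ν`, by
morphisms `φ i : B → A ⊗ C`, then `(b i) ↦ (φ i (b i))` is a morphism `Bⁿ → Aⁿ ⊗ C` under the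
identification of `Aⁿ ⊗ C` with `(A ⊗ C)ⁿ`, and slicing it by `ν` gives the direct sum. A common
pair `(C, ν)` always exists: the tensor product of the individual parameter algebras with the
product state, since a product state restricts to each factor as the given state
(`RQM.exists_common`).

For the convex sum, `Θ` moves the coordinate of `Aⁿ` into a factor `ℂⁿ` of the parameter algebra.
The state `σ ⊗ ν` then weights the coordinates: on `a ⊗ c`, slicing after `Θ` gives `∑ i, t i ν(c) a
i`, the `t`-average of the coordinates of the `ν`-slice (`SpatialTensor.slice_distrib`). Feeding in
a diagonal element `(b, …, b)` turns these coordinates into `F i b`. Nothing about the implementing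
triple is used beyond the fact that it implements the direct sum, so the argument covers every such
triple.

Two tools carry this out. `StarAlgHom.sumMulProj` glues morphisms along a partition of unity by
projections; it yields both the morphism into `Aⁿ ⊗ C` and `Θ`. `SpatialTensor.eq_of_tmul` reduces
each identity to elementary tensors; it needs continuity, which comes from the contractivity of
slices and of `f ⊗ g` in the spatial norm. -/

/-- If the `p i` are orthogonal projections with sum `1`, each commuting with the range of `f i`, then
`x ↦ ∑ i, f i x * p i` is a unital *-homomorphism. -/
def StarAlgHom.sumMulProj {X Y ι : Type*} [Fintype ι] [Ring X] [StarRing X] [Algebra ℂ X]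
    [Ring Y] [StarRing Y] [Algebra ℂ Y] (f : ι → X →⋆ₐ[ℂ] Y) (p : ι → Y)
    (hstar : ∀ i, star (p i) = p i) (hidem : ∀ i, p i * p i = p i)
    (horth : ∀ i j, i ≠ j → p i * p j = 0) (hsum : ∑ i, p i = 1)
    (hcomm : ∀ i x, Commute (p i) (f i x)) : X →⋆ₐ[ℂ] Y where
  toFun x := ∑ i, f i x * p i
  map_one' := by simp [hsum]
  map_mul' x y := by
    rw [Finset.sum_mul_sum]
    refine Finset.sum_congr rfl fun i _ => ?_
    -- Only the diagonal terms survive: in `f i x * p i * (f j y * p j)`, the factor `p j` moves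
    -- left past `f j y` and meets `p i`, and the product is zero for `j ≠ i`.
    rw [Finset.sum_eq_single i]
    · rw [_root_.map_mul, mul_assoc (f i x), mul_assoc (f i x), ← mul_assoc (p i), (hcomm i y).eq,
        mul_assoc (f i y), hidem]
    · intro j _ hj
      rw [← (hcomm j y).eq, mul_assoc, ← mul_assoc (p i), horth i j hj.symm, zero_mul, mul_zero]
    · simp
  map_zero' := by simp
  map_add' x y := by simp [add_mul, Finset.sum_add_distrib]
  commutes' r := by
    have h : ∀ i, f i (algebraMap ℂ X r) = algebraMap ℂ Y r := fun i => AlgHomClass.commutes (f i) r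
    simp only [h]
    rw [← Finset.mul_sum, hsum, mul_one]
  map_star' x := by
    rw [star_sum]
    refine Finset.sum_congr rfl fun i _ => ?_
    rw [star_mul, hstar, map_star, ← map_star, (hcomm i (star x)).eq]

theorem StarAlgHom.sumMulProj_apply {X Y ι : Type*} [Fintype ι] [Ring X] [StarRing X]
    [Algebra ℂ X] [Ring Y] [StarRing Y] [Algebra ℂ Y] (f : ι → X →⋆ₐ[ℂ] Y) (p : ι → Y)
    (hstar : ∀ i, star (p i) = p i) (hidem : ∀ i, p i * p i = p i)
    (horth : ∀ i j, i ≠ j → p i * p j = 0) (hsum : ∑ i, p i = 1)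
    (hcomm : ∀ i x, Commute (p i) (f i x)) (x : X) :
    StarAlgHom.sumMulProj f p hstar hidem horth hsum hcomm x = ∑ i, f i x * p i := rfl

/-! ### Functoriality of the algebraic tensor product for the spatial norm -/

namespace AlgTensor

variable {A A' : Type u} {C C' : Type w} [CStarAlgebra A] [CStarAlgebra A'] [CStarAlgebra C]
  [CStarAlgebra C']

/-- The *-homomorphism `f ⊗ g` of algebraic tensor products. -/
noncomputable def map (f : A →⋆ₐ[ℂ] A') (g : C →⋆ₐ[ℂ] C') : AlgTensor A C →⋆ₐ[ℂ] AlgTensor A' C' where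
  toAlgHom := (Algebra.TensorProduct.map f.toAlgHom g.toAlgHom : A ⊗[ℂ] C →ₐ[ℂ] A' ⊗[ℂ] C')
  map_star' x := by
    let F : AlgTensor A C →ₐ[ℂ] AlgTensor A' C' :=
      (Algebra.TensorProduct.map f.toAlgHom g.toAlgHom : A ⊗[ℂ] C →ₐ[ℂ] A' ⊗[ℂ] C')
    change F (star x) = star (F x)
    induction x using induction with
    | h0 => simp
    | ha x y hx hy => rw [star_add, _root_.map_add, _root_.map_add, star_add, hx, hy]
    | ht a c =>
      change tmul (f (star a)) (g (star c)) = tmul (star (f a)) (star (g c))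
      rw [map_star, map_star]

theorem map_tmul (f : A →⋆ₐ[ℂ] A') (g : C →⋆ₐ[ℂ] C') (a : A) (c : C) :
    map f g (tmul a c) = tmul (f a) (g c) := rfl

/-- Composing `π ⊗ ρ` with `f ⊗ g` gives `(π ∘ f) ⊗ (ρ ∘ g)`, again a pair of representations of the
kind over which the spatial norm of `x` is a supremum. Since `A` and `A'` share a universe, as do
`C` and `C'`, the pulled-back pair lives on admissible Hilbert spaces. -/
theorem norm_map_le (f : A →⋆ₐ[ℂ] A') (g : C →⋆ₐ[ℂ] C') (x : AlgTensor A C) :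
    ‖map f g x‖ ≤ ‖x‖ := by
  refine spatialNorm_le (spatialNorm_nonneg x) ?_
  intro H _ _ _ K _ _ _ π ρ
  have h : pairRep π ρ (map f g x) = pairRep (π.comp f) (ρ.comp g) x := by
    induction x using induction with
    | h0 => simp
    | ha x y hx hy => rw [_root_.map_add, _root_.map_add, _root_.map_add, hx, hy]
    | ht a c => rfl
  rw [h]
  exact norm_pairRep_le _ _ x

end AlgTensor

/-! ### Elementary tensors, embeddings and functoriality of the completed tensor product -/

namespace SpatialTensor

variable {A A' : Type u} {C C' : Type w} [CStarAlgebra A] [CStarAlgebra A'] [CStarAlgebra C]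
  [CStarAlgebra C']

/-- Continuous additive maps on `A ⊗ C` that agree on elementary tensors are equal. -/
theorem eq_of_tmul {E : Type*} [NormedAddCommGroup E] {S T : SpatialTensor A C → E}
    (hS : Continuous S) (hT : Continuous T) (hSa : ∀ x y, S (x + y) = S x + S y)
    (hTa : ∀ x y, T (x + y) = T x + T y) (h : ∀ a c, S (tmul a c) = T (tmul a c))
    (x : SpatialTensor A C) : S x = T x := by
  refine denseRange_of.induction_on (p := fun x => S x = T x) x (isClosed_eq hS hT) fun x => ?_
  induction x using AlgTensor.induction with
  | h0 =>
    rw [_root_.map_zero]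
    exact ((AddMonoidHom.mk' S hSa).map_zero).trans ((AddMonoidHom.mk' T hTa).map_zero).symm
  | ha x y hx hy => rw [_root_.map_add, hSa, hTa, hx, hy]
  | ht a c => exact h a c

theorem tmul_mul_tmul (a a' : A) (c c' : C) :
    tmul a c * tmul a' c' = tmul (a * a') (c * c') := by
  rw [tmul, tmul, ← _root_.map_mul, AlgTensor.tmul_mul_tmul, tmul]

theorem star_tmul (a : A) (c : C) : star (tmul a c) = tmul (star a) (star c) := by
  rw [tmul, ← map_star, AlgTensor.star_tmul, tmul]

theorem one_tmul_one : tmul (1 : A) (1 : C) = 1 := _root_.map_one of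

theorem add_tmul (a a' : A) (c : C) : tmul (a + a') c = tmul a c + tmul a' c :=
  (congrArg of (TensorProduct.add_tmul a a' c)).trans (_root_.map_add of _ _)

theorem tmul_add (a : A) (c c' : C) : tmul a (c + c') = tmul a c + tmul a c' :=
  (congrArg of (TensorProduct.tmul_add a c c')).trans (_root_.map_add of _ _)

theorem sum_tmul {ι : Type*} (s : Finset ι) (a : ι → A) (c : C) :
    tmul (∑ i ∈ s, a i) c = ∑ i ∈ s, tmul (a i) c :=
  map_sum (AddMonoidHom.mk' (fun a : A => tmul a c) fun a a' => add_tmul a a' c) a s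

theorem zero_tmul (c : C) : tmul (0 : A) c = 0 :=
  (congrArg of (TensorProduct.zero_tmul A c)).trans (_root_.map_zero of)

theorem tmul_zero (a : A) : tmul a (0 : C) = 0 :=
  (congrArg of (TensorProduct.tmul_zero C a)).trans (_root_.map_zero of)

theorem smul_tmul (r : ℂ) (a : A) (c : C) : tmul (r • a) c = r • tmul a c :=
  (congrArg of (TensorProduct.smul_tmul' r a c).symm).trans (_root_.map_smul of _ _)

theorem tmul_smul (r : ℂ) (a : A) (c : C) : tmul a (r • c) = r • tmul a c :=
  (congrArg of (TensorProduct.tmul_smul r a c)).trans (_root_.map_smul of _ _)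

/-- An element commuting with all elementary tensors is central. -/
theorem commute_of_tmul {z : SpatialTensor A C} (h : ∀ a c, Commute z (tmul a c))
    (x : SpatialTensor A C) : Commute z x := by
  exact eq_of_tmul (S := fun x => z * x) (T := fun x => x * z) (by fun_prop) (by fun_prop)
    (fun x y => mul_add z x y) (fun x y => add_mul x y z) (fun a c => (h a c).eq) x

/-- The embedding `a ↦ a ⊗ 1`. -/
noncomputable def inl : A →⋆ₐ[ℂ] SpatialTensor A C where
  toFun a := tmul a 1
  map_one' := one_tmul_one
  map_mul' a a' := by rw [tmul_mul_tmul, one_mul]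
  map_zero' := zero_tmul 1
  map_add' a a' := add_tmul a a' 1
  commutes' r := by
    rw [Algebra.algebraMap_eq_smul_one, Algebra.algebraMap_eq_smul_one, smul_tmul, one_tmul_one]
  map_star' a := by rw [star_tmul, star_one]

theorem inl_apply (a : A) : (inl a : SpatialTensor A C) = tmul a 1 := rfl

/-- The embedding `c ↦ 1 ⊗ c`. -/
noncomputable def inr : C →⋆ₐ[ℂ] SpatialTensor A C where
  toFun c := tmul 1 c
  map_one' := one_tmul_one
  map_mul' c c' := by rw [tmul_mul_tmul, one_mul]
  map_zero' := tmul_zero 1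
  map_add' c c' := tmul_add 1 c c'
  commutes' r := by
    rw [Algebra.algebraMap_eq_smul_one, Algebra.algebraMap_eq_smul_one, tmul_smul, one_tmul_one]
  map_star' c := by rw [star_tmul, star_one]

theorem inr_apply (c : C) : (inr c : SpatialTensor A C) = tmul 1 c := rfl

/-- The continuous linear map underlying `f ⊗ g`. -/
noncomputable def mapL (f : A →⋆ₐ[ℂ] A') (g : C →⋆ₐ[ℂ] C') :
    SpatialTensor A C →L[ℂ] SpatialTensor A' C' :=
  ((of.toAlgHom.toLinearMap ∘ₗ (AlgTensor.map f g).toAlgHom.toLinearMap).mkContinuous 1 fun x => by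
    rw [one_mul]
    exact (norm_of _).trans_le (AlgTensor.norm_map_le f g x) :
      AlgTensor A C →L[ℂ] SpatialTensor A' C').fromCompletion

theorem mapL_of (f : A →⋆ₐ[ℂ] A') (g : C →⋆ₐ[ℂ] C') (x : AlgTensor A C) :
    mapL f g (of x) = of (AlgTensor.map f g x) :=
  ContinuousLinearMap.fromCompletion_apply_coe _ x

/-- The *-homomorphism `f ⊗ g : A ⊗ C → A' ⊗ C'`. -/
noncomputable def map (f : A →⋆ₐ[ℂ] A') (g : C →⋆ₐ[ℂ] C') :
    SpatialTensor A C →⋆ₐ[ℂ] SpatialTensor A' C' where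
  toFun := mapL f g
  map_one' := by
    rw [← _root_.map_one of, mapL_of, _root_.map_one, _root_.map_one]
  map_mul' x y := by
    refine denseRange_of.induction_on₂
      (p := fun x y => mapL f g (x * y) = mapL f g x * mapL f g y) ?_ (fun x y => ?_) x y
    · exact isClosed_eq (by fun_prop) (by fun_prop)
    · rw [← _root_.map_mul, mapL_of, mapL_of, mapL_of, _root_.map_mul, _root_.map_mul]
  map_zero' := _root_.map_zero _
  map_add' := _root_.map_add _
  commutes' r := by
    rw [Algebra.algebraMap_eq_smul_one, Algebra.algebraMap_eq_smul_one, _root_.map_smul,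
      ← _root_.map_one of, mapL_of, _root_.map_one, _root_.map_one]
  map_star' x := by
    refine denseRange_of.induction_on
      (p := fun x => mapL f g (star x) = star (mapL f g x)) x ?_ fun x => ?_
    · exact isClosed_eq (by fun_prop) (by fun_prop)
    · rw [← map_star, mapL_of, mapL_of, map_star, map_star]

theorem continuous_map (f : A →⋆ₐ[ℂ] A') (g : C →⋆ₐ[ℂ] C') : Continuous (map f g) :=
  (mapL f g).continuous

theorem map_tmul (f : A →⋆ₐ[ℂ] A') (g : C →⋆ₐ[ℂ] C') (a : A) (c : C) :
    map f g (tmul a c) = tmul (f a) (g c) :=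
  mapL_of f g _

/-- Slicing is compatible with a morphism of parameter algebras that preserves the states. -/
theorem slice_map_id (g : C →⋆ₐ[ℂ] C') (ν : CStarState C) (ν' : CStarState C')
    (h : ∀ c, ν' (g c) = ν c) (x : SpatialTensor A C) :
    slice ν' (map (StarAlgHom.id ℂ A) g x) = slice ν x := by
  refine eq_of_tmul (S := fun x => slice ν' (map (StarAlgHom.id ℂ A) g x)) (T := slice ν)
    ((slice ν').continuous.comp (continuous_map _ g)) (slice ν).continuous
    (fun x y => by rw [_root_.map_add, _root_.map_add]) (_root_.map_add _) (fun a c => ?_) x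
  rw [map_tmul, slice_tmul, slice_tmul, h]
  rfl

end SpatialTensor

/-! ### A common parameter algebra -/

/-- Finitely many random quantum maps can be put on a common parameter algebra with a common
state. -/
theorem RQM.exists_common {A : Type u} {B : Type v} [CStarAlgebra A] [CStarAlgebra B] (k : ℕ)
    (R : Fin (k + 1) → RQM.{u, v, w} B A) :
    ∃ (C : Type w) (_ : CStarAlgebra C) (ν : CStarState C)
      (φ : Fin (k + 1) → B →⋆ₐ[ℂ] SpatialTensor A C),
      ∀ i b, SpatialTensor.slice ν (φ i b) = (R i).operator b := by
  induction k with
  | zero =>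
    refine ⟨(R 0).C, inferInstance, (R 0).ν, fun _ => (R 0).φ, fun i b => ?_⟩
    rw [Fin.fin_one_eq_zero i]
    rfl
  | succ k ih =>
    obtain ⟨C, _, ν, φ, h⟩ := ih fun i => R i.castSucc
    let R' := R (Fin.last (k + 1))
    -- The earlier maps enter through `c ↦ c ⊗ 1` and the new one through `c ↦ 1 ⊗ c`. As both
    -- states take the value 1 at 1, the product state pulls back to `ν` and to `R'.ν`, so no slice
    -- changes.
    refine ⟨SpatialTensor C R'.C, inferInstance, ν.prod R'.ν,
      Fin.snoc (α := fun _ => B →⋆ₐ[ℂ] SpatialTensor A (SpatialTensor C R'.C))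
        (fun i => (SpatialTensor.map (StarAlgHom.id ℂ A) SpatialTensor.inl).comp (φ i))
        ((SpatialTensor.map (StarAlgHom.id ℂ A) SpatialTensor.inr).comp R'.φ), fun i b => ?_⟩
    induction i using Fin.lastCases with
    | last =>
      rw [Fin.snoc_last, StarAlgHom.comp_apply, SpatialTensor.slice_map_id _ R'.ν]
      · rfl
      · intro c
        rw [SpatialTensor.inr_apply, CStarState.prod_tmul, ν.map_one, one_mul]
    | cast i =>
      rw [Fin.snoc_castSucc, StarAlgHom.comp_apply, SpatialTensor.slice_map_id _ ν, h]
      intro c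
      rw [SpatialTensor.inl_apply, CStarState.prod_tmul, R'.ν.map_one, mul_one]

namespace SpatialTensor

/-! ### The morphism into `Aⁿ ⊗ C` that implements the direct sum -/

section DirectSum

variable {A : Type u} {B : Type v} {C : Type w} [CStarAlgebra A] [CStarAlgebra B] [CStarAlgebra C]
  {n : ℕ}

/-- The projections `e i ⊗ 1` of `Aⁿ ⊗ C`. -/
noncomputable def piProj (A : Type u) (C : Type w) [CStarAlgebra A] [CStarAlgebra C] {n : ℕ}
    (i : Fin n) : SpatialTensor (Fin n → A) C :=
  tmul (Pi.single i 1) 1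

theorem star_piProj (i : Fin n) : star (piProj A C i) = piProj A C i := by
  rw [piProj, star_tmul, star_one, ← Pi.single_star, star_one]

theorem piProj_mul_self (i : Fin n) : piProj A C i * piProj A C i = piProj A C i := by
  rw [piProj, tmul_mul_tmul, ← Pi.single_mul, one_mul, one_mul]

theorem piProj_mul_of_ne {i j : Fin n} (h : i ≠ j) : piProj A C i * piProj A C j = 0 := by
  rw [piProj, piProj, tmul_mul_tmul]
  convert zero_tmul (A := Fin n → A) (1 * 1 : C)
  ext k
  rcases eq_or_ne k i with rfl | hk <;> simp [*]

theorem sum_piProj : ∑ i : Fin n, piProj A C i = 1 := by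
  simp only [piProj]
  rw [← sum_tmul, ← one_tmul_one]
  congr 1
  exact Finset.univ_sum_single (1 : Fin n → A)

/-- Multiplication by `e i` keeps coordinate `i` and kills the others, from either side. Hence `e i
⊗ 1` commutes with elementary tensors, and density gives the rest. -/
theorem commute_piProj (i : Fin n) (x : SpatialTensor (Fin n → A) C) :
    Commute (piProj A C i) x := by
  refine commute_of_tmul (fun a c => ?_) x
  rw [Commute, SemiconjBy, piProj, tmul_mul_tmul, tmul_mul_tmul, one_mul, mul_one]
  congr 1
  ext j
  rcases eq_or_ne j i with rfl | h <;> simp [*]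

/-- The morphism `Bⁿ → Aⁿ ⊗ C`, `(b i)ᵢ ↦ (φ i (b i))ᵢ`, of a family of morphisms
`φ i : B → A ⊗ C`. -/
noncomputable def piHom (φ : Fin n → B →⋆ₐ[ℂ] SpatialTensor A C) :
    (Fin n → B) →⋆ₐ[ℂ] SpatialTensor (Fin n → A) C :=
  StarAlgHom.sumMulProj
    -- The `i`-th morphism places `φ i (b i)` in every coordinate of `Aⁿ ⊗ C`, which keeps it
    -- unital; the factor `e i ⊗ 1` then retains coordinate `i` alone.
    (fun i => ((map (diagonalHom A n) (StarAlgHom.id ℂ C)).comp (φ i)).comp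
      (Pi.evalStarAlgHom ℂ (fun _ : Fin n => B) i))
    (piProj A C) star_piProj piProj_mul_self (fun _ _ h => piProj_mul_of_ne h) sum_piProj
    fun i _ => commute_piProj i _

/-- This evaluates one summand of `piHom`. On `a ⊗ c` the product is `(a e i) ⊗ c`, whose slice has
`ν(c) a` in slot `i` and zero elsewhere. -/
theorem slice_map_diagonal_mul_piProj (ν : CStarState C) (i : Fin n) (x : SpatialTensor A C) :
    slice ν (map (diagonalHom A n) (StarAlgHom.id ℂ C) x * piProj A C i) =
      Pi.single i (slice ν x) := by
  refine eq_of_tmul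
    (S := fun x => slice ν (map (diagonalHom A n) (StarAlgHom.id ℂ C) x * piProj A C i))
    (T := fun x => Pi.single i (slice ν x))
    ((slice ν).continuous.comp ((continuous_map _ _).mul continuous_const))
    ((continuous_single i).comp (slice ν).continuous)
    (fun x y => by rw [_root_.map_add, add_mul, _root_.map_add])
    (fun x y => by rw [_root_.map_add, Pi.single_add]) (fun a c => ?_) x
  rw [map_tmul, piProj, tmul_mul_tmul, slice_tmul, slice_tmul, mul_one]
  ext j
  rcases eq_or_ne j i with rfl | h
  · simp
    rfl
  · simp [h]

theorem slice_piHom (ν : CStarState C) (φ : Fin n → B →⋆ₐ[ℂ] SpatialTensor A C) (b : Fin n → B) :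
    slice ν (piHom φ b) = fun i => slice ν (φ i (b i)) := by
  rw [piHom, StarAlgHom.sumMulProj_apply, map_sum]
  refine (Finset.sum_congr rfl fun i _ => slice_map_diagonal_mul_piProj ν i (φ i (b i))).trans ?_
  exact Finset.univ_sum_single fun i => slice ν (φ i (b i))

end DirectSum

/-! ### The morphism `Θ` and its slices -/

section Distrib

variable {A : Type u} {C : Type w} [CStarAlgebra A] [CStarAlgebra C] {n : ℕ}

/-- The morphism `Aⁿ ⊗ C → A ⊗ (ℂⁿ ⊗ C)`, `a ⊗ c ↦ ∑ i, a i ⊗ (e i ⊗ c)`. -/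
noncomputable def distrib (A : Type u) (C : Type w) [CStarAlgebra A] [CStarAlgebra C] (n : ℕ) :
    SpatialTensor (Fin n → A) C →⋆ₐ[ℂ] SpatialTensor A (SpatialTensor (Fin n → ℂ) C) :=
  -- The `i`-th morphism sends `a ⊗ c` to `a i ⊗ (1 ⊗ c)`, and multiplication by `1 ⊗ (e i ⊗ 1)`
  -- then inserts `e i` in the middle factor.
  StarAlgHom.sumMulProj (fun i => map (Pi.evalStarAlgHom ℂ (fun _ : Fin n => A) i) inr)
    (fun i => inr (piProj ℂ C i))
    (fun i => by rw [← map_star, star_piProj])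
    (fun i => by rw [← _root_.map_mul, piProj_mul_self])
    (fun i j h => by rw [← _root_.map_mul, piProj_mul_of_ne h, _root_.map_zero])
    (by rw [← map_sum, sum_piProj, _root_.map_one])
    -- Centrality of `e i ⊗ 1` in `ℂⁿ ⊗ C` passes to `1 ⊗ (e i ⊗ 1)`.
    fun i _ => commute_of_tmul (fun a c => by
      rw [Commute, SemiconjBy, inr_apply, tmul_mul_tmul, tmul_mul_tmul, one_mul, mul_one,
        (commute_piProj i c).eq]) _

theorem distrib_tmul (a : Fin n → A) (c : C) :
    distrib A C n (tmul a c) = ∑ i, tmul (a i) (tmul (Pi.single i 1) c) := by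
  rw [distrib, StarAlgHom.sumMulProj_apply]
  refine Finset.sum_congr rfl fun i _ => ?_
  rw [map_tmul, inr_apply, inr_apply, tmul_mul_tmul, piProj, tmul_mul_tmul, mul_one, one_mul,
    mul_one]
  rfl

theorem continuous_distrib : Continuous (distrib A C n) := by
  have h : ∀ i, Continuous fun x : SpatialTensor (Fin n → A) C =>
      map (Pi.evalStarAlgHom ℂ (fun _ : Fin n => A) i) inr x *
        (inr (piProj ℂ C i) : SpatialTensor A (SpatialTensor (Fin n → ℂ) C)) :=
    fun i => (continuous_map _ _).mul continuous_const
  exact continuous_finsetSum Finset.univ fun i _ => h i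

/-- The computation behind part (b): on `a ⊗ c` the summand `a i ⊗ (e i ⊗ c)` slices to `t i ν(c) a
i`, because `σ(e i) = t i`. Both sides are continuous and additive in `x`, so elementary tensors
suffice. -/
theorem slice_distrib (t : Fin n → ℝ) (ht : ∀ i, 0 ≤ t i) (hsum : ∑ i, t i = 1) (ν : CStarState C)
    (x : SpatialTensor (Fin n → A) C) :
    slice ((CStarState.ofWeights t ht hsum).prod ν) (distrib A C n x) =
      ∑ i, (t i : ℂ) • slice ν x i := by
  have hw : ∀ i, CStarState.ofWeights t ht hsum (Pi.single i 1) = t i := by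
    intro i
    change (∑ j, (t j : ℂ) • LinearMap.proj j : (Fin n → ℂ) →ₗ[ℂ] ℂ) (Pi.single i 1) = t i
    simp [LinearMap.sum_apply, Pi.single_apply]
  refine eq_of_tmul
    (S := fun x => slice ((CStarState.ofWeights t ht hsum).prod ν) (distrib A C n x))
    (T := fun x => ∑ i, (t i : ℂ) • slice ν x i)
    ((slice _).continuous.comp continuous_distrib) (by fun_prop)
    (fun x y => by rw [_root_.map_add, _root_.map_add])
    (fun x y => by simp [Finset.sum_add_distrib]) (fun a c => ?_) x
  rw [distrib_tmul, map_sum]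
  refine Finset.sum_congr rfl fun i _ => ?_
  rw [slice_tmul, CStarState.prod_tmul, hw, mul_smul, slice_tmul]
  rfl

end Distrib

end SpatialTensor

/-! ### Implementation of direct sums and convex sums -/

namespace NFMO

variable {A : Type u} {B : Type v} [CStarAlgebra A] [PartialOrder A] [StarOrderedRing A]
  [CStarAlgebra B] [PartialOrder B] [StarOrderedRing B]

/-- The index set is `Fin (k + 1)` because the construction of a common parameter algebra starts
from that of the first member of the family. -/
theorem implemented_directSum {k : ℕ} (F : Fin (k + 1) → NFMO B A)
    (hF : ∀ i, Implemented.{u, v, w} (F i)) : Implemented.{u, v, w} (directSum F) := by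
  choose R hR using hF
  obtain ⟨C, _, ν, φ, h⟩ := RQM.exists_common k R
  refine ⟨⟨C, SpatialTensor.piHom φ, ν⟩, LinearMap.ext fun b => ?_⟩
  change (fun i => (F i).toLinearMap (b i)) = SpatialTensor.slice ν (SpatialTensor.piHom φ b)
  rw [SpatialTensor.slice_piHom]
  funext i
  rw [h, hR i]

theorem implementedBy_convexSum {n : ℕ} (F : Fin n → NFMO B A) (t : Fin n → ℝ) (ht : ∀ i, 0 ≤ t i)
    (hsum : ∑ i, t i = 1) (R : RQM.{u, v, w} (Fin n → B) (Fin n → A))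
    (hR : (directSum F).ImplementedBy R) :
    (convexSum F t ht hsum).ImplementedBy
      { C := SpatialTensor (Fin n → ℂ) R.C
        φ := ((SpatialTensor.distrib A R.C n).comp R.φ).comp (diagonalHom B n)
        ν := (CStarState.ofWeights t ht hsum).prod R.ν } := by
  refine LinearMap.ext fun b => ?_
  -- The hypothesis on `R` is needed only at the constant sequence `(b, …, b)`.
  have h : SpatialTensor.slice R.ν (R.φ (diagonalHom B n b)) = fun i => (F i).toLinearMap b :=
    (LinearMap.congr_fun hR (diagonalHom B n b)).symm
  change (∑ i, (t i : ℂ) • (F i).toLinearMap) b =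
    SpatialTensor.slice ((CStarState.ofWeights t ht hsum).prod R.ν)
      (SpatialTensor.distrib A R.C n (R.φ (diagonalHom B n b)))
  rw [SpatialTensor.slice_distrib, h, LinearMap.sum_apply]
  rfl

end NFMO

theorem mainTheorem2 {A : Type u} {B : Type v}
    [CStarAlgebra A] [PartialOrder A] [StarOrderedRing A]
    [CStarAlgebra B] [PartialOrder B] [StarOrderedRing B]
    {n : ℕ} (F : Fin n → NFMO B A) (hF : ∀ i, NFMO.Implemented.{u, v, w} (F i))
    (t : Fin n → ℝ) (ht : ∀ i, 0 ≤ t i) (hsum : ∑ i, t i = 1) :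
    NFMO.Implemented.{u, v, w} (NFMO.convexSum F t ht hsum) ∧
    NFMO.Implemented.{u, v, w} (NFMO.directSum F) ∧
    ∀ R : RQM.{u, v, w} (Fin n → B) (Fin n → A), (NFMO.directSum F).ImplementedBy R →
      ∃ Θ : SpatialTensor (Fin n → A) R.C →⋆ₐ[ℂ] SpatialTensor A (SpatialTensor (Fin n → ℂ) R.C),
        (∀ (a : Fin n → A) (c : R.C), Θ (SpatialTensor.tmul a c) =
          ∑ i, SpatialTensor.tmul (a i) (SpatialTensor.tmul (Pi.single i 1) c)) ∧
        (NFMO.convexSum F t ht hsum).ImplementedBy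
          { C := SpatialTensor (Fin n → ℂ) R.C
            φ := (Θ.comp R.φ).comp (diagonalHom B n)
            ν := (CStarState.ofWeights t ht hsum).prod R.ν } := by
  -- An empty family of weights would sum to 0 rather than 1, so the family is nonempty.
  have hn : n ≠ 0 := by
    rintro rfl
    simp at hsum
  obtain ⟨k, rfl⟩ := Nat.exists_eq_succ_of_ne_zero hn
  have hD := NFMO.implemented_directSum F hF
  refine ⟨?_, hD, fun R hR => ⟨SpatialTensor.distrib A R.C _, SpatialTensor.distrib_tmul,
    NFMO.implementedBy_convexSum F t ht hsum R hR⟩⟩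
  -- The convex sum is implemented by applying (b) to a triple supplied by (a).
  obtain ⟨R, hR⟩ := hD
  exact ⟨_, NFMO.implementedBy_convexSum F t ht hsum R hR⟩
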